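/- **Proposition 2.** Let $\mathbb V=\mathbb R^n$ or $\mathbb V=\mathbb C^n$. Let $A_1,\dots,A_m$ be symmetric (respectively hermitian) $n\times n$ matrices, $v_1,\dots,v_m\in\mathbb V$, $f^0\in\mathbb R^m$, and let $f:\mathbb V\to\mathbb R^m$ be the quadratic map $f_i(x)=x^*A_ix-v_i^*x-x^*v_i+f^0_i$. For $c\in\mathbb R^m$ write $c\cdot A=\sum_i c_iA_i$, and similarly $c\cdot v=\sum_i c_iv_i$. Let $c_+\in\mathbb R^m\setminus\{0\}$ be such that $A_+:=c_+\cdot A$ is positive definite; put $|x|_+^2:=x^*A_+x$ and $x_0:=A_+^{-1}(c_+\cdot v)$. Let $\lambda^+_{\min}(M)$ be the smallest generalized eigenvalue of $M$ with respect to $A_+$, i.e. the smallest $\lambda\in\mathbb R$ such that $(M-\lambda A_+)x=0$ for some $x\neq0$. Define $z_{\max}\in[0,\infty]$ by $$z_{\max}:=\limsup_{\epsilon\to0^+}\ \min_{c\in\mathcal C}\left|\left(c\cdot A-\lambda^+_{\min}(c\cdot A)A_++\epsilon I\right)^{-1}c\cdot(v-Ax_0)\right|_+^2,\qquad \mathcal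 C=\{c\in\mathbb R^m:\ |c|^2=1,\ c\cdot c_+=0\},$$ which is the limit as $\epsilon\to0^+$ whenever that limit exists; here $c\cdot(v-Ax_0)=\sum_i c_i(v_i-A_ix_0)$, and the minimum is $\infty$ if $\mathcal C$ is empty (i.e. $m=1$). Assume $\dim_{\mathbb R}\mathbb V\neq m-1$. Then: 1. the set $\mathscr F(f,c_+,z_{\max})=\{f(x):x\in\mathbb V,\ |x-x_0|_+^2\le z_{\max}\}$ is convex; 2. if $z_{\max}<\infty$, this set is compact, and it is the part of the image cut off by a hyperplane orthogonal to $c_+$: $\mathscr F(f,c_+,z_{\max})=f(\mathbb V)\cap\{y\in\mathbb R^m: c_+\cdot y\le c_+\cdot f(x_0)+z_{\max}\}$; 3. if $z_{\max}=\infty$, the whole image $f(\mathbb V)$ is convex. -/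

import Mathlib

open scoped ComplexOrder ENNReal Topology Matrix

noncomputable section

namespace QuadMap

variable {𝕜 : Type*} [RCLike 𝕜] {m n : ℕ}

/-- The combination `c · A = ∑ i, c i • A i` of an `m`-tuple of matrices. -/
def combMat (c : Fin m → ℝ) (A : Fin m → Matrix (Fin n) (Fin n) 𝕜) : Matrix (Fin n) (Fin n) 𝕜 :=
  ∑ i, (c i : 𝕜) • A i

/-- The combination `c · v = ∑ i, c i • v i` of an `m`-tuple of vectors. -/
def combVec (c : Fin m → ℝ) (v : Fin m → Fin n → 𝕜) : Fin n → 𝕜 :=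
  ∑ i, (c i : 𝕜) • v i

/-- The quadratic map `f i x = x^* (A i) x - (v i)^* x - x^* (v i) + f0 i`. For hermitian `A i` this
number is real, so that taking the real part only changes its type. -/
def quadMap (A : Fin m → Matrix (Fin n) (Fin n) 𝕜) (v : Fin m → Fin n → 𝕜) (f0 : Fin m → ℝ)
    (x : Fin n → 𝕜) : Fin m → ℝ :=
  fun i => RCLike.re (star x ⬝ᵥ (A i *ᵥ x) - star (v i) ⬝ᵥ x - star x ⬝ᵥ v i) + f0 i

/-- The squared norm `|x|_P ^ 2 = x^* P x` given by a positive definite matrix `P`. -/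
def normSqOf (P : Matrix (Fin n) (Fin n) 𝕜) (x : Fin n → 𝕜) : ℝ :=
  RCLike.re (star x ⬝ᵥ (P *ᵥ x))

/-- The smallest generalized eigenvalue of `M` with respect to `P`: the least real `l` for which
`(M - l P) x = 0` has a solution `x ≠ 0`. -/
def minGenEig (P M : Matrix (Fin n) (Fin n) 𝕜) : ℝ :=
  sInf {l : ℝ | ∃ x : Fin n → 𝕜, x ≠ 0 ∧ (M - (l : 𝕜) • P) *ᵥ x = 0}

/-- The point `x₀ = (c₊ · A)⁻¹ (c₊ · v)`. -/
def basePoint (A : Fin m → Matrix (Fin n) (Fin n) 𝕜) (v : Fin m → Fin n → 𝕜) (cp : Fin m → ℝ) :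
    Fin n → 𝕜 :=
  (combMat cp A)⁻¹ *ᵥ combVec cp v

/-- The minimized quantity
`|(c · A - λ⁺_min(c · A) A₊ + ε)⁻¹ c · (v - A x₀)|₊ ^ 2`, where `A₊ = c₊ · A`. -/
def objective (A : Fin m → Matrix (Fin n) (Fin n) 𝕜) (v : Fin m → Fin n → 𝕜) (cp : Fin m → ℝ)
    (ε : ℝ) (c : Fin m → ℝ) : ℝ :=
  normSqOf (combMat cp A)
    ((combMat c A - (minGenEig (combMat cp A) (combMat c A) : 𝕜) • combMat cp A
        + (ε : 𝕜) • (1 : Matrix (Fin n) (Fin n) 𝕜))⁻¹ *ᵥ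
      combVec c (fun i => v i - A i *ᵥ basePoint A v cp))

/-- The minimum of `objective` over the unit vectors `c` orthogonal to `c₊`, in `[0, ∞]`
(it is `∞` if there are no such vectors, that is, if `m = 1`). -/
def minObjective (A : Fin m → Matrix (Fin n) (Fin n) 𝕜) (v : Fin m → Fin n → 𝕜)
    (cp : Fin m → ℝ) (ε : ℝ) : ℝ≥0∞ :=
  ⨅ c ∈ {c : Fin m → ℝ | c ⬝ᵥ c = 1 ∧ c ⬝ᵥ cp = 0}, ENNReal.ofReal (objective A v cp ε c)

/-- `z_max ∈ [0, ∞]`: the limit of `minObjective` as `ε → 0⁺`. It is taken as an upper limit, so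
that no existence of the limit has to be assumed; see `zMax_eq_of_tendsto`. -/
def zMax (A : Fin m → Matrix (Fin n) (Fin n) 𝕜) (v : Fin m → Fin n → 𝕜) (cp : Fin m → ℝ) : ℝ≥0∞ :=
  Filter.limsup (fun ε : ℝ => minObjective A v cp ε) (𝓝[>] 0)

theorem zMax_eq_of_tendsto {A : Fin m → Matrix (Fin n) (Fin n) 𝕜} {v : Fin m → Fin n → 𝕜}
    {cp : Fin m → ℝ} {z : ℝ≥0∞}
    (h : Filter.Tendsto (fun ε : ℝ => minObjective A v cp ε) (𝓝[>] 0) (𝓝 z)) :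
    zMax A v cp = z :=
  h.limsup_eq

/-- The part `{f x : |x - x₀|₊ ^ 2 ≤ z_max}` of the image. -/
def cutImage (A : Fin m → Matrix (Fin n) (Fin n) 𝕜) (v : Fin m → Fin n → 𝕜) (f0 : Fin m → ℝ)
    (cp : Fin m → ℝ) : Set (Fin m → ℝ) :=
  quadMap A v f0 ''
    {x | ENNReal.ofReal (normSqOf (combMat cp A) (x - basePoint A v cp)) ≤ zMax A v cp}

end QuadMap

end

/-! Centre `𝕍` at `x₀`. Then `c₊ · f` is a constant plus `|y|₊ ^ 2`, so a convex combination `p` of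
two values of `f` with `|y|₊ ^ 2 < z_max` satisfies `f y - p ⟂ c₊` on a whole level set
`|y|₊ ^ 2 = z` with `z < z_max`. For arbitrarily small `ε > 0` and every unit vector `c ⟂ c₊`, the
definition of `z_max` provides a Lagrange multiplier `l ≤ λ⁺_min(c · A)` for the minimization of
`c · f + ε |y| ^ 2` on this level set. So there is a minimizer `x c` with
`c · (f (x c) - p) = O(ε)`, around which the minimized function grows quadratically; the growth
makes `x` Lipschitz in `c`.
Now `dim c₊ᗮ = m - 1 < dim 𝕍`: if `m - 1 > dim 𝕍`, some `c · (v - A x₀)` vanishes and `z_max = 0`.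
A Lipschitz image of `c₊ᗮ` is therefore null in `𝕍`, and `x` extends from the unit sphere of `c₊ᗮ`
to the ball with values in the level set. By Brouwer's theorem `f - p` is `O(ε)` somewhere on the
level set, which is compact, so `p` is a value of `f`.

Brouwer's theorem follows from the absence of a `C¹` retraction `r` of the ball onto the sphere: the
integral of `det (1 + t (Dr - 1))` over the ball is a polynomial in `t` that is constant for small
`t`, hence also at `t = 1`, where the integrand vanishes. -/

section Brouwer

open Metric MeasureTheory Polynomial Set

theorem exists_mem_frontier_dist_le {E : Type*} [NormedAddCommGroup E]
    [NormedSpace ℝ E] {s : Set E} (hs : IsClosed s) {x y : E} (hx : x ∈ s)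
    (hy : y ∉ s) : ∃ z ∈ frontier s, dist x z ≤ dist x y := by
  obtain ⟨z, hz, hzs⟩ : (segment ℝ x y ∩ frontier s).Nonempty := by
    by_contra hempty
    rw [not_nonempty_iff_eq_empty, hs.frontier_eq] at hempty
    have hint : ∀ w ∈ segment ℝ x y, w ∈ s → w ∈ interior s := fun w hw hws => by
      by_contra hwi
      exact (hempty ▸ (⟨hw, hws, hwi⟩ : w ∈ segment ℝ x y ∩ (s \ interior s)) : w ∈ (∅ : Set E))
    obtain ⟨w, -, hw, hws⟩ := (convex_segment x y).isPreconnected (interior s) sᶜ isOpen_interior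
      hs.isOpen_compl (fun w hw => (em (w ∈ s)).imp (hint w hw) id)
      ⟨x, left_mem_segment ℝ x y, hint x (left_mem_segment ℝ x y) hx⟩
      ⟨y, right_mem_segment ℝ x y, hy⟩
    exact hws (interior_subset hw)
  have hdist := dist_add_dist_of_mem_segment hz
  exact ⟨z, hzs, by linarith [dist_nonneg (x := z) (y := y)]⟩

theorem lipschitzWith_indicator_of_eq_zero_frontier {E G : Type*} [NormedAddCommGroup E]
    [NormedSpace ℝ E] [NormedAddCommGroup G] {s : Set E} (hs : IsClosed s) {f : E → G} {K : NNReal}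
    (hf : LipschitzOnWith K f s) (h0 : ∀ x ∈ frontier s, f x = 0) :
    LipschitzWith K (s.indicator f) := by
  have hmixed : ∀ x ∈ s, ∀ y ∉ s, dist (s.indicator f x) (s.indicator f y) ≤ K * dist x y := by
    intro x hx y hy
    obtain ⟨z, hz, hxz⟩ := exists_mem_frontier_dist_le hs hx hy
    calc dist (s.indicator f x) (s.indicator f y) = dist (f x) (f z) := by
          rw [indicator_of_mem hx, indicator_of_notMem hy, h0 z hz]
      _ ≤ K * dist x z := hf.dist_le_mul x hx z (hs.frontier_subset hz)
      _ ≤ K * dist x y := by gcongr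
  refine LipschitzWith.of_dist_le_mul fun x y => ?_
  by_cases hx : x ∈ s <;> by_cases hy : y ∈ s
  · simpa [hx, hy] using hf.dist_le_mul x hx y hy
  · exact hmixed x hx y hy
  · simpa only [dist_comm] using hmixed y hy x hx
  · simp only [indicator_of_notMem hx, indicator_of_notMem hy, dist_self]
    positivity

theorem integral_polynomial_eval_eq_of_infinite {α : Type*} [MeasurableSpace α] {μ : Measure α}
    {q : α → ℝ[X]} {d : ℕ} (hq : ∀ x, (q x).natDegree ≤ d) {S : Set ℝ} (hS : S.Infinite) {V : ℝ}
    (hint : ∀ t ∈ S, Integrable (fun x => (q x).eval t) μ)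
    (hV : ∀ t ∈ S, ∫ x, (q x).eval t ∂μ = V) (r : ℝ) : ∫ x, (q x).eval r ∂μ = V := by
  classical
  obtain ⟨s, hsS, hsd⟩ := hS.exists_subset_card_eq (d + 1)
  have hinj : InjOn (id : ℝ → ℝ) s := injOn_id _
  have hinterp (x : α) :
      (q x).eval r = ∑ t ∈ s, (q x).eval t * (Lagrange.basis s id t).eval r := by
    have hdeg : (q x).degree < s.card :=
      degree_le_natDegree.trans_lt (by rw [hsd]; exact_mod_cast Nat.lt_succ_of_le (hq x))
    conv_lhs => rw [Lagrange.eq_interpolate hinj hdeg, Lagrange.interpolate_apply]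
    simp only [eval_finsetSum, eval_mul, eval_C, id]
  have hsum : ∑ t ∈ s, (Lagrange.basis s id t).eval r = 1 := by
    rw [← eval_finsetSum, Lagrange.sum_basis hinj (Finset.card_pos.1 (by lia)), eval_one]
  simp only [hinterp]
  rw [integral_finsetSum _ fun t ht => (hint t (hsS ht)).mul_const _]
  calc ∑ t ∈ s, ∫ x, (q x).eval t * (Lagrange.basis s id t).eval r ∂μ
      = ∑ t ∈ s, V * (Lagrange.basis s id t).eval r :=
        Finset.sum_congr rfl fun t ht => by rw [integral_mul_const, hV t (hsS ht)]
    _ = V := by rw [← Finset.mul_sum, hsum, mul_one]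

theorem exists_polynomial_eval_eq_det_one_add_smul {R M : Type*} [CommRing R] [Nontrivial R]
    [AddCommGroup M] [Module R M] [Module.Free R M] [Module.Finite R M] (D : M →ₗ[R] M) :
    ∃ q : R[X], q.natDegree ≤ Module.finrank R M ∧
      ∀ t, q.eval t = LinearMap.det (1 + t • D) := by
  let b := Module.Free.chooseBasis R M
  let N := LinearMap.toMatrix b b D
  refine ⟨((X : R[X]) • N.map C + (1 : Matrix _ _ R).map C).det, ?_, fun t => ?_⟩
  · rw [Module.finrank_eq_card_chooseBasisIndex]
    exact natDegree_det_X_add_C_le N 1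
  · rw [← LinearMap.det_toMatrix b, map_add, map_smul, LinearMap.toMatrix_one,
      ← coe_evalRingHom, RingHom.map_det]
    congr 1
    ext i j
    simp [N, add_comm, Matrix.one_apply, apply_ite, mul_comm (D.toMatrix b b i j)]

variable {E : Type*} [NormedAddCommGroup E] [NormedSpace ℝ E] [FiniteDimensional ℝ E]

theorem det_one_add_pos {D : E →L[ℝ] E} (hD : ‖D‖ < 1) : 0 < (1 + D).det := by
  have hne : ∀ t ∈ Icc (0 : ℝ) 1, (1 + t • D).det ≠ 0 := by
    intro t ht
    have hlt : ‖-(t • D)‖ < 1 := by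
      rw [norm_neg, norm_smul, Real.norm_of_nonneg ht.1]
      exact (mul_le_of_le_one_left (norm_nonneg D) ht.2).trans_lt hD
    have hunit : IsUnit (1 + t • D) := by simpa using isUnit_one_sub_of_norm_lt_one hlt
    exact ((hunit.map ContinuousLinearMap.toLinearMapRingHom).map LinearMap.det).ne_zero
  have hcont : ContinuousOn (fun t : ℝ => (1 + t • D).det) (Icc 0 1) :=
    (ContinuousLinearMap.continuous_det.comp (by fun_prop)).continuousOn
  by_contra! hneg
  obtain ⟨t, ht, ht0⟩ := intermediate_value_Icc' zero_le_one hcont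
    (show (0 : ℝ) ∈ Icc _ _ from ⟨by simpa using hneg, by
      rw [zero_smul, add_zero]
      exact zero_le_one.trans_eq (LinearMap.det_id (M := E) (A := ℝ)).symm⟩)
  exact hne t ht ht0

theorem bijective_self_add_of_lipschitzWith {E : Type*} [NormedAddCommGroup E] [NormedSpace ℝ E]
    [CompleteSpace E] {φ : E → E} {K : NNReal} (hφ : LipschitzWith K φ)
    (hK : K < 1) : Function.Bijective fun x => x + φ x := by
  have happ : ApproximatesLinearOn (fun x => x + φ x)
      ((ContinuousLinearEquiv.refl ℝ E : E ≃L[ℝ] E) : E →L[ℝ] E) univ K := by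
    intro x _ y _
    simpa [add_sub_add_comm] using hφ.norm_sub_le x y
  have hc : Subsingleton E ∨ K < ‖((ContinuousLinearEquiv.refl ℝ E).symm : E →L[ℝ] E)‖₊⁻¹ := by
    rcases subsingleton_or_nontrivial E with hE | hE
    · exact Or.inl hE
    · have hnorm : ‖((ContinuousLinearEquiv.refl ℝ E).symm : E →L[ℝ] E)‖₊ = 1 := by ext; simp
      exact Or.inr (by rwa [hnorm, inv_one])
  refine ⟨fun x y hxy => ?_, happ.surjective hc⟩
  exact congrArg Subtype.val (happ.injective hc (a₁ := ⟨x, mem_univ x⟩) (a₂ := ⟨y, mem_univ y⟩) hxy)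

theorem image_eq_of_eqOn_compl {α : Type*} {h : α → α} (hbij : Function.Bijective h) {s : Set α}
    (hfix : EqOn h id sᶜ) : h '' s = s := by
  rw [← compl_inj_iff, ← image_compl_eq hbij, hfix.image_eq, image_id]

section Volume

variable [MeasurableSpace E] [BorelSpace E] (μ : Measure E) [μ.IsAddHaarMeasure]

theorem integrableOn_det_and_setIntegral_det_of_lt_one {s : Set E} (hs : MeasurableSet s)
    (hμs : μ s ≠ ∞) {φ : E → E} {K : NNReal} (hφ : LipschitzWith K φ) (hK : K < 1)
    (hout : ∀ x ∉ s, φ x = 0) (hd : ∀ x ∈ s, DifferentiableAt ℝ φ x) :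
    IntegrableOn (fun x => (1 + fderiv ℝ φ x).det) s μ ∧
      ∫ x in s, (1 + fderiv ℝ φ x).det ∂μ = μ.real s := by
  have hbij := bijective_self_add_of_lipschitzWith hφ hK
  have himg : (fun x => x + φ x) '' s = s :=
    image_eq_of_eqOn_compl hbij fun x hx => by simp [hout x hx]
  have hder : ∀ x ∈ s, HasFDerivWithinAt (fun x => x + φ x) (1 + fderiv ℝ φ x) s x := fun x hx =>
    ((hasFDerivAt_id x).add (hd x hx).hasFDerivAt).hasFDerivWithinAt
  have habs : EqOn (fun x => |(1 + fderiv ℝ φ x).det| • (1 : ℝ))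
      (fun x => (1 + fderiv ℝ φ x).det) s := fun x _ => by
    have hnorm : ‖fderiv ℝ φ x‖ < 1 :=
      (norm_fderiv_le_of_lipschitz ℝ hφ).trans_lt (by exact_mod_cast hK)
    simp [abs_of_pos (det_one_add_pos hnorm)]
  constructor
  · rw [← integrableOn_congr_fun habs hs, ← integrableOn_image_iff_integrableOn_abs_det_fderiv_smul
      μ hs hder hbij.injective.injOn (fun _ => (1 : ℝ)), himg]
    exact integrableOn_const hμs
  · rw [← setIntegral_congr_fun hs habs, ← integral_image_eq_integral_abs_det_fderiv_smul
      μ hs hder hbij.injective.injOn (fun _ => (1 : ℝ)), himg]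
    simp [Measure.real]

theorem setIntegral_det_one_add_fderiv {s : Set E} (hs : MeasurableSet s) (hμs : μ s ≠ ∞)
    {φ : E → E} {K : NNReal} (hφ : LipschitzWith K φ) (hout : ∀ x ∉ s, φ x = 0)
    (hd : ∀ x ∈ s, DifferentiableAt ℝ φ x) :
    ∫ x in s, (1 + fderiv ℝ φ x).det ∂μ = μ.real s := by
  choose q hdeg hq using fun x =>
    exists_polynomial_eval_eq_det_one_add_smul (fderiv ℝ φ x : E →ₗ[ℝ] E)
  have hsmul : ∀ t ∈ Ioo (0 : ℝ) (1 / (K + 1)),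
      IntegrableOn (fun x => (q x).eval t) s μ ∧ ∫ x in s, (q x).eval t ∂μ = μ.real s := by
    intro t ht
    have hKt : ‖t‖₊ * K < 1 := by
      have htK : t * (K + 1) < 1 := (lt_div_iff₀ (by positivity)).1 ht.2
      have : ‖t‖ * K < 1 := by rw [Real.norm_of_nonneg ht.1.le]; linarith [ht.1]
      exact_mod_cast this
    have hdet (x : E) : (q x).eval t = (1 + fderiv ℝ (t • φ) x).det := by
      rw [hq, fderiv_const_smul_field]; rfl
    simp only [hdet]
    exact integrableOn_det_and_setIntegral_det_of_lt_one μ hs hμs ((lipschitzWith_smul t).comp hφ)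
      hKt (fun x hx => by simp [hout x hx]) fun x hx => (hd x hx).const_smul t
  have hone := integral_polynomial_eval_eq_of_infinite hdeg
    (Ioo_infinite (show (0 : ℝ) < 1 / (K + 1) by positivity)) (fun t ht => (hsmul t ht).1)
    (fun t ht => (hsmul t ht).2) 1
  simp only [hq, one_smul] at hone
  exact hone

end Volume

theorem exists_det_one_add_fderiv_ne_zero {s : Set E} (hs : IsOpen s) (hne : s.Nonempty)
    (hb : Bornology.IsBounded s) {φ : E → E} {K : NNReal} (hφ : LipschitzWith K φ)
    (hout : ∀ x ∉ s, φ x = 0) (hd : ∀ x ∈ s, DifferentiableAt ℝ φ x) :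
    ∃ x ∈ s, (1 + fderiv ℝ φ x).det ≠ 0 := by
  by_contra! hdet
  let _ : MeasurableSpace E := borel E
  have : BorelSpace E := ⟨rfl⟩
  let μ : Measure E := Measure.addHaar
  have hvol := setIntegral_det_one_add_fderiv μ hs.measurableSet hb.measure_lt_top.ne hφ hout hd
  rw [setIntegral_congr_fun hs.measurableSet hdet, setIntegral_const, smul_zero] at hvol
  exact (ENNReal.toReal_pos (hs.measure_pos μ hne).ne' hb.measure_lt_top.ne).ne hvol

variable {F : Type*} [NormedAddCommGroup F] [InnerProductSpace ℝ F] [FiniteDimensional ℝ F]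

theorem det_fderiv_eq_zero_of_norm_eventually_eq_one {r : F → F} {x : F}
    (hr : DifferentiableAt ℝ r x) (hn : ∀ᶠ y in 𝓝 x, ‖r y‖ = 1) : (fderiv ℝ r x).det = 0 := by
  have hperp (v : F) : inner ℝ (r x) (fderiv ℝ r x v) = 0 := by
    have hconst : (fun y => ‖r y‖ ^ 2) =ᶠ[𝓝 x] fun _ => 1 := hn.mono fun y hy => by simp [hy]
    have hder := (hr.hasFDerivAt.norm_sq.congr_of_eventuallyEq hconst.symm).unique
      (hasFDerivAt_const 1 x)
    simpa using DFunLike.congr_fun hder v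
  by_contra hdet
  obtain ⟨v, hv⟩ := (LinearMap.equivOfDetNeZero _ hdet).surjective (r x)
  have hv' : fderiv ℝ r x v = r x := hv
  have hzero := hperp v
  rw [hv', real_inner_self_eq_norm_sq, hn.self_of_nhds] at hzero
  norm_num at hzero

theorem not_contDiffAt_retraction_sphere [Nontrivial F] {r : F → F}
    (hn : ∀ x ∈ closedBall (0 : F) 1, ‖r x‖ = 1) (hid : ∀ x ∈ sphere (0 : F) 1, r x = x) :
    ¬ ∀ x ∈ closedBall (0 : F) 1, ContDiffAt ℝ 1 r x := by
  intro hr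
  let ψ : F → F := (closedBall (0 : F) 1).indicator fun x => r x - x
  have hdiff : ContDiffOn ℝ 1 (fun x => r x - x) (closedBall 0 1) := fun x hx =>
    ((hr x hx).sub contDiffAt_id).contDiffWithinAt
  obtain ⟨K, hK⟩ := hdiff.exists_lipschitzOnWith one_ne_zero (convex_closedBall 0 1)
    (isCompact_closedBall 0 1)
  have hψ : LipschitzWith K ψ :=
    lipschitzWith_indicator_of_eq_zero_frontier isClosed_closedBall hK fun x hx => by
      rw [frontier_closedBall 0 one_ne_zero] at hx
      rw [hid x hx, sub_self]
  have hev : ∀ x ∈ ball (0 : F) 1, ψ =ᶠ[𝓝 x] fun y => r y - y := fun x hx =>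
    Filter.eventuallyEq_of_mem (isOpen_ball.mem_nhds hx) fun y hy =>
      indicator_of_mem (ball_subset_closedBall hy) _
  have hrd : ∀ x ∈ ball (0 : F) 1, DifferentiableAt ℝ r x := fun x hx =>
    (hr x (ball_subset_closedBall hx)).differentiableAt one_ne_zero
  have hψd : ∀ x ∈ ball (0 : F) 1, DifferentiableAt ℝ ψ x := fun x hx =>
    ((hrd x hx).sub differentiableAt_id).congr_of_eventuallyEq (hev x hx)
  have hout : ∀ x ∉ ball (0 : F) 1, ψ x = 0 := by
    intro x hx
    by_cases hxs : x ∈ closedBall (0 : F) 1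
    · simp only [ψ, indicator_of_mem hxs]
      rw [hid x (by rw [← closedBall_sdiff_ball]; exact ⟨hxs, hx⟩), sub_self]
    · exact indicator_of_notMem hxs _
  have hdet : ∀ x ∈ ball (0 : F) 1, (1 + fderiv ℝ ψ x).det = 0 := fun x hx => by
    have hfd : 1 + fderiv ℝ ψ x = fderiv ℝ r x := by
      rw [(hev x hx).fderiv_eq, fderiv_fun_sub (hrd x hx) differentiableAt_fun_id,
        fderiv_fun_id]
      exact add_sub_cancel _ _
    rw [hfd]
    exact det_fderiv_eq_zero_of_norm_eventually_eq_one (hrd x hx)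
      (Filter.eventually_of_mem (isOpen_ball.mem_nhds hx) fun y hy =>
        hn y (ball_subset_closedBall hy))
  obtain ⟨x, hx, hx0⟩ := exists_det_one_add_fderiv_ne_zero isOpen_ball (nonempty_ball.2 one_pos)
    isBounded_ball hψ hout hψd
  exact hx0 (hdet x hx)

theorem exists_zero_of_contDiff_of_inner_pos {q : F → F} (hq : ContDiff ℝ 1 q)
    (hpos : ∀ c ∈ sphere (0 : F) 1, 0 < inner ℝ c (q c)) : ∃ c ∈ closedBall (0 : F) 1, q c = 0 := by
  rcases subsingleton_or_nontrivial F with hF | hF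
  · exact ⟨0, by simp, Subsingleton.elim _ _⟩
  by_contra! hne
  have hclosed : IsClosed (closedBall (0 : F) 1 ∩ {c | inner ℝ c (q c) ≤ 0}) :=
    isClosed_closedBall.inter
      (isClosed_le (continuous_id.inner hq.continuous) continuous_const)
  obtain ⟨χ, hχ0, hχ1, hχ⟩ := exists_contMDiffMap_zero_one_of_isClosed (n := 1)
    (modelWithCornersSelf ℝ F)
    (isClosed_sphere (x := (0 : F)) (ε := 1)) hclosed
    (disjoint_left.2 fun c hc hc' => (hpos c hc).not_ge hc'.2)
  -- `G` is `q` where `inner ℝ c (q c) ≤ 0` and the identity on the sphere, so that `G / ‖G‖` would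
  -- be a retraction onto the sphere.
  let G : F → F := fun c => χ c • q c + (1 - χ c) • c
  have hG : ContDiff ℝ 1 G :=
    (χ.contMDiff.contDiff.smul hq).add ((contDiff_const.sub χ.contMDiff.contDiff).smul contDiff_id)
  have hG0 : ∀ c ∈ closedBall (0 : F) 1, G c ≠ 0 := by
    intro c hc hGc
    rcases le_or_gt (inner ℝ c (q c)) 0 with hle | hgt
    · simp [G, hχ1 ⟨hc, hle⟩, hne c hc] at hGc
    · have hin : inner ℝ c (G c) = χ c * inner ℝ c (q c) + (1 - χ c) * ‖c‖ ^ 2 := by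
        simp only [G, inner_add_right, real_inner_smul_right, real_inner_self_eq_norm_sq]
      have hc0 : 0 < ‖c‖ ^ 2 := by
        have : c ≠ 0 := fun h => by simp [h] at hgt
        positivity
      rw [hGc, inner_zero_right] at hin
      nlinarith [mul_nonneg (hχ c).1 hgt.le, mul_nonneg (sub_nonneg.2 (hχ c).2) hc0.le]
  refine not_contDiffAt_retraction_sphere (r := fun c => ‖G c‖⁻¹ • G c)
    (fun c hc => norm_smul_inv_norm (𝕜 := ℝ) (hG0 c hc)) (fun c hc => ?_) fun c hc =>
    ((hG.contDiffAt.norm ℝ (hG0 c hc)).inv (norm_ne_zero_iff.2 (hG0 c hc))).smul hG.contDiffAt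
  have hc1 : ‖c‖ = 1 := by simpa using hc
  simp [G, hχ0 hc, hc1]

theorem exists_norm_lt_of_inner_nonpos {g : F → F} (hg : Continuous g)
    (hb : ∀ c ∈ sphere (0 : F) 1, inner ℝ c (g c) ≤ 0) {η : ℝ} (hη : 0 < η) :
    ∃ c ∈ closedBall (0 : F) 1, ‖g c‖ < η := by
  obtain ⟨δ, hδ, rfl⟩ : ∃ δ > 0, η = 3 * δ := ⟨η / 3, by positivity, by ring⟩
  obtain ⟨q, hq, hqg, -⟩ := Continuous.exists_contDiff_approx 1
    (f := fun c => (2 * δ) • c - g c) (by fun_prop) (continuous_const (y := δ)) fun _ => hδ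
  simp only [dist_eq_norm] at hqg
  obtain ⟨c, hc, hqc⟩ := exists_zero_of_contDiff_of_inner_pos (q := q) (by exact_mod_cast hq)
    fun c hc => by
      have hc1 : ‖c‖ = 1 := by simpa using hc
      have hle := (abs_real_inner_le_norm c (q c - ((2 * δ) • c - g c))).trans_lt
        (by rw [hc1, one_mul]; exact hqg c)
      have hin : inner ℝ c (q c - ((2 * δ) • c - g c)) =
          inner ℝ c (q c) - 2 * δ + inner ℝ c (g c) := by
        simp only [inner_sub_right, real_inner_smul_right, real_inner_self_eq_norm_sq, hc1]
        ring
      linarith [neg_lt_of_abs_lt hle, hb c hc]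
  refine ⟨c, hc, ?_⟩
  have hnear : ‖g c - (2 * δ) • c‖ < δ := by simpa [hqc] using hqg c
  have hsmul : ‖(2 * δ) • c‖ ≤ 2 * δ := by
    rw [norm_smul, Real.norm_of_nonneg (by positivity)]
    exact mul_le_of_le_one_right (by positivity) (by simpa using hc)
  linarith [norm_sub_norm_le (g c) ((2 * δ) • c)]

theorem exists_zero_of_inner_nonpos {g : F → F} (hg : ContinuousOn g (closedBall 0 1))
    (hb : ∀ c ∈ sphere (0 : F) 1, inner ℝ c (g c) ≤ 0) : ∃ c ∈ closedBall (0 : F) 1, g c = 0 := by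
  obtain ⟨G, hG⟩ := ContinuousMap.exists_restrict_eq (isClosed_closedBall (x := (0 : F)) (ε := 1))
    ⟨_, hg.domRestrict⟩
  have hGg : ∀ c ∈ closedBall (0 : F) 1, G c = g c := fun c hc => DFunLike.congr_fun hG ⟨c, hc⟩
  obtain ⟨c₀, hc₀, hmin⟩ := (isCompact_closedBall (0 : F) 1).exists_isMinOn ⟨0, by simp⟩ hg.norm
  refine ⟨c₀, hc₀, norm_le_zero_iff.1 (le_of_forall_pos_lt_add fun η hη => ?_)⟩
  obtain ⟨c, hc, hlt⟩ := exists_norm_lt_of_inner_nonpos G.continuous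
    (fun c hc => by rw [hGg c (sphere_subset_closedBall hc)]; exact hb c hc)
    hη
  rw [hGg c hc] at hlt
  linarith [show ‖g c₀‖ ≤ ‖g c‖ from hmin hc]

end Brouwer

section Extension

open Metric Module

variable {F E : Type*} [NormedAddCommGroup F] [NormedSpace ℝ F] [FiniteDimensional ℝ F]
  [NormedAddCommGroup E] [NormedSpace ℝ E] [FiniteDimensional ℝ E]

theorem exists_forall_ne_smul_of_lipschitzWith (hFE : finrank ℝ F < finrank ℝ E) {K : NNReal}
    {X : F → E} (hX : LipschitzWith K X) : ∃ w, ∀ c ∈ ball (0 : F) 1, X c ≠ (1 - ‖c‖) • w := by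
  have hlip : ∀ c ∈ ball (0 : F) 1, ∃ C : NNReal, ∃ t ∈ 𝓝[ball 0 1] c,
      LipschitzOnWith C (fun c => (1 - ‖c‖)⁻¹ • X c) t := by
    intro c hc
    have hne : 1 - ‖c‖ ≠ 0 := by rw [mem_ball_zero_iff] at hc; linarith
    have hdiff : ContDiffAt ℝ 1 (fun p : ℝ × E => (1 - p.1)⁻¹ • p.2) (‖c‖, X c) :=
      ((contDiffAt_const.sub contDiffAt_fst).inv hne).smul contDiffAt_snd
    obtain ⟨C, t, ht, hC⟩ := hdiff.exists_lipschitzOnWith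
    have hpair := lipschitzWith_one_norm.prodMk hX
    exact ⟨_, _, mem_nhdsWithin_of_mem_nhds (hpair.continuous.continuousAt ht),
      hC.comp hpair.lipschitzOnWith (Set.mapsTo_preimage _ t)⟩
  have hdim : dimH ((fun c => (1 - ‖c‖)⁻¹ • X c) '' ball 0 1) < finrank ℝ E :=
    calc dimH ((fun c => (1 - ‖c‖)⁻¹ • X c) '' ball 0 1)
      _ ≤ dimH (ball (0 : F) 1) := dimH_image_le_of_locally_lipschitzOn hlip
      _ ≤ dimH (Set.univ : Set F) := dimH_mono (Set.subset_univ _)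
      _ = finrank ℝ F := Real.dimH_univ_eq_finrank F
      _ < finrank ℝ E := by exact_mod_cast hFE
  obtain ⟨w, hw⟩ := (dense_compl_of_dimH_lt_finrank hdim).nonempty
  refine ⟨w, fun c hc hXc => hw ⟨c, hc, ?_⟩⟩
  have hne : 1 - ‖c‖ ≠ 0 := by rw [mem_ball_zero_iff] at hc; linarith
  simp only [hXc, inv_smul_smul₀ hne]

theorem exists_continuous_extension_ne_zero (hFE : finrank ℝ F < finrank ℝ E) {K : NNReal}
    {x : F → E} (hx : LipschitzOnWith K x (sphere 0 1)) (hx0 : ∀ c ∈ sphere (0 : F) 1, x c ≠ 0) :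
    ∃ X : F → E, Continuous X ∧ Set.EqOn X x (sphere 0 1) ∧
      ∀ c ∈ closedBall (0 : F) 1, X c ≠ 0 := by
  obtain ⟨Y, hY, hYx⟩ := hx.extend_finite_dimension
  obtain ⟨w, hw⟩ := exists_forall_ne_smul_of_lipschitzWith hFE hY
  have hXx : Set.EqOn (fun c => Y c - (1 - ‖c‖) • w) x (sphere 0 1) := fun c hc => by
    simp [mem_sphere_zero_iff_norm.1 hc, hYx hc]
  refine ⟨fun c => Y c - (1 - ‖c‖) • w, ?_, hXx, fun c hc => ?_⟩
  · exact hY.continuous.sub ((continuous_const.sub continuous_norm).smul continuous_const)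
  · rcases (mem_closedBall_zero_iff.1 hc).eq_or_lt with hc1 | hc1
    · have hcs := mem_sphere_zero_iff_norm.2 hc1
      rw [hXx hcs]
      exact hx0 c hcs
    · exact sub_ne_zero.2 (hw c (mem_ball_zero_iff.2 hc1))

theorem exists_continuousOn_extension_levelSet (hFE : finrank ℝ F < finrank ℝ E) {q : E → ℝ}
    (hq : Continuous q) (hhom : ∀ (t : ℝ) (y : E), q (t • y) = t ^ 2 * q y)
    (hpos : ∀ y, y ≠ 0 → 0 < q y) {z : ℝ} (hz : 0 < z) {K : NNReal} {x : F → E}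
    (hx : LipschitzOnWith K x (sphere 0 1)) (hxz : ∀ c ∈ sphere (0 : F) 1, q (x c) = z) :
    ∃ X : F → E, ContinuousOn X (closedBall 0 1) ∧ Set.EqOn X x (sphere 0 1) ∧
      ∀ c ∈ closedBall (0 : F) 1, q (X c) = z := by
  have hq0 : q 0 = 0 := by simpa using hhom 0 0
  obtain ⟨Y, hYc, hYx, hY0⟩ := exists_continuous_extension_ne_zero hFE hx fun c hc h0 => by
    have := hxz c hc
    rw [h0, hq0] at this
    exact hz.ne this
  refine ⟨fun c => √(z / q (Y c)) • Y c, ?_, fun c hc => ?_, fun c hc => ?_⟩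
  · exact (continuousOn_const.div (hq.comp hYc).continuousOn fun c hc =>
      (hpos _ (hY0 c hc)).ne').sqrt.smul hYc.continuousOn
  · simp only [hYx hc, hxz c hc, div_self hz.ne', Real.sqrt_one, one_smul]
  · have hp := hpos _ (hY0 c hc)
    rw [hhom, Real.sq_sqrt (by positivity), div_mul_cancel₀ _ hp.ne']

end Extension

section Homogeneous

open Metric

variable {E : Type*} [NormedAddCommGroup E] [NormedSpace ℝ E] {q : E → ℝ}

theorem exists_forall_div_mul_le [FiniteDimensional ℝ E] [Nontrivial E] {r : E → ℝ}
    (hq : Continuous q) (hqhom : ∀ (t : ℝ) (y : E), q (t • y) = t ^ 2 * q y)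
    (hpos : ∀ y, y ≠ 0 → 0 < q y) (hr : Continuous r)
    (hrhom : ∀ (t : ℝ) (y : E), r (t • y) = t ^ 2 * r y) :
    ∃ y₀ ≠ 0, ∀ y, r y₀ / q y₀ * q y ≤ r y := by
  have hne : ∀ y ∈ sphere (0 : E) 1, y ≠ 0 := fun y hy => ne_zero_of_mem_unit_sphere ⟨y, hy⟩
  obtain ⟨y₀, hy₀, hmin⟩ := (isCompact_sphere (0 : E) 1).exists_isMinOn
    (NormedSpace.sphere_nonempty.2 zero_le_one)
    (hr.continuousOn.div hq.continuousOn fun y hy => (hpos y (hne y hy)).ne')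
  refine ⟨y₀, hne y₀ hy₀, fun y => ?_⟩
  rcases eq_or_ne y 0 with rfl | hy
  · simp [show q 0 = 0 by simpa using hqhom 0 0, show r 0 = 0 by simpa using hrhom 0 0]
  · have hn : ‖y‖⁻¹ ^ 2 ≠ 0 := by positivity
    have hle : r y₀ / q y₀ ≤ r (‖y‖⁻¹ • y) / q (‖y‖⁻¹ • y) :=
      hmin (mem_sphere_zero_iff_norm.2 (norm_smul_inv_norm (𝕜 := ℝ) hy))
    rwa [hqhom, hrhom, mul_div_mul_left _ _ hn, le_div_iff₀ (hpos y hy)] at hle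

theorem exists_pos_forall_mul_norm_sq_le [FiniteDimensional ℝ E] (hq : Continuous q)
    (hhom : ∀ (t : ℝ) (y : E), q (t • y) = t ^ 2 * q y) (hpos : ∀ y, y ≠ 0 → 0 < q y) :
    ∃ δ > 0, ∀ y, δ * ‖y‖ ^ 2 ≤ q y := by
  rcases subsingleton_or_nontrivial E with hE | hE
  · have hq0 : q 0 = 0 := by simpa using hhom 0 0
    exact ⟨1, one_pos, fun y => by simp [Subsingleton.elim y 0, hq0]⟩
  obtain ⟨y₀, hy₀, hle⟩ := exists_forall_div_mul_le (q := fun y => ‖y‖ ^ 2) (by fun_prop)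
    (fun t y => by rw [norm_smul, mul_pow, Real.norm_eq_abs, sq_abs]) (fun y hy => by positivity)
    hq hhom
  exact ⟨_, div_pos (hpos y₀ hy₀) (by positivity), hle⟩

theorem isCompact_setOf_le [FiniteDimensional ℝ E] (hq : Continuous q)
    (hhom : ∀ (t : ℝ) (y : E), q (t • y) = t ^ 2 * q y) (hpos : ∀ y, y ≠ 0 → 0 < q y) (z : ℝ) :
    IsCompact {y | q y ≤ z} := by
  obtain ⟨δ, hδ, hle⟩ := exists_pos_forall_mul_norm_sq_le hq hhom hpos
  refine (isCompact_closedBall (0 : E) √(z / δ)).of_isClosed_subset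
    (isClosed_le hq continuous_const) fun y hy => ?_
  refine mem_closedBall_zero_iff.2 (Real.le_sqrt_of_sq_le ?_)
  rw [le_div_iff₀ hδ, mul_comm]
  exact (hle y).trans hy

theorem setOf_le_subset_closure_setOf_lt (hhom : ∀ (t : ℝ) (y : E), q (t • y) = t ^ 2 * q y)
    {z : ℝ} (hz : 0 < z) : {y | q y ≤ z} ⊆ closure {y | q y < z} := by
  intro y hy
  have hlim : Filter.Tendsto (fun t : ℝ => t • y) (𝓝[<] 1) (𝓝 y) := by
    have : Filter.Tendsto (fun t : ℝ => t • y) (𝓝 1) (𝓝 ((1 : ℝ) • y)) :=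
      (continuous_id.smul continuous_const).tendsto 1
    rw [one_smul] at this
    exact this.mono_left nhdsWithin_le_nhds
  refine mem_closure_of_tendsto hlim ?_
  filter_upwards [Ioo_mem_nhdsLT zero_lt_one] with t ht
  have ht2 : t ^ 2 < 1 := pow_lt_one₀ ht.1.le ht.2 two_ne_zero
  change q (t • y) < z
  rw [hhom]
  change q y ≤ z at hy
  nlinarith [sq_pos_of_pos ht.1]

end Homogeneous

section LevelSet

open Metric Module RealInnerProductSpace

variable {E F : Type*} [NormedAddCommGroup E] [NormedAddCommGroup F] [InnerProductSpace ℝ F]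

theorem lipschitzOnWith_of_forall_add_mul_sq_le {φ : E → F} {S : Set E} {L : NNReal}
    (hφ : LipschitzOnWith L φ S) {N : E → ℝ} {κ : NNReal} (hκ : 0 < κ) {T : Set F} {x : F → E}
    (hxS : Set.MapsTo x T S)
    (hmin : ∀ c ∈ T, ∀ u ∈ S, ⟪c, φ (x c)⟫ + N (x c) + κ * ‖u - x c‖ ^ 2 ≤ ⟪c, φ u⟫ + N u) :
    LipschitzOnWith (L / (2 * κ)) x T := by
  refine LipschitzOnWith.of_dist_le_mul fun c hc d hd => ?_
  have hinner : 2 * κ * dist (x c) (x d) ^ 2 ≤ ⟪c - d, φ (x d) - φ (x c)⟫ := by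
    have hcd := hmin c hc (x d) (hxS hd)
    have hdc := hmin d hd (x c) (hxS hc)
    rw [norm_sub_rev] at hcd
    simp only [dist_eq_norm, inner_sub_left, inner_sub_right]
    linarith
  have hbound : ⟪c - d, φ (x d) - φ (x c)⟫ ≤ dist c d * (L * dist (x c) (x d)) :=
    (real_inner_le_norm _ _).trans (by
      rw [dist_eq_norm c, ← dist_eq_norm (φ (x d)), dist_comm (φ (x d))]
      gcongr
      exact hφ.dist_le_mul _ (hxS hc) _ (hxS hd))
  have hκ2 : (0 : ℝ) < 2 * κ := by positivity
  rw [NNReal.coe_div, NNReal.coe_mul, NNReal.coe_ofNat, div_mul_eq_mul_div, le_div_iff₀ hκ2]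
  rcases dist_nonneg (x := x c) (y := x d) |>.eq_or_lt with h0 | h0
  · rw [← h0, zero_mul]
    positivity
  · exact le_of_mul_le_mul_right (by linarith [hinner.trans hbound]) h0

variable [NormedSpace ℝ E] [FiniteDimensional ℝ E] {q : E → ℝ} {z : ℝ}

theorem exists_levelSet_norm_le [FiniteDimensional ℝ F] (hFE : finrank ℝ F < finrank ℝ E)
    (hq : Continuous q) (hhom : ∀ (t : ℝ) (y : E), q (t • y) = t ^ 2 * q y)
    (hpos : ∀ y, y ≠ 0 → 0 < q y) (hz : 0 < z) {K : NNReal} {x : F → E}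
    (hx : LipschitzOnWith K x (sphere 0 1)) (hxz : ∀ c ∈ sphere (0 : F) 1, q (x c) = z)
    {g : E → F} (hg : Continuous g) {r : ℝ} (hr : 0 ≤ r)
    (hgx : ∀ c ∈ sphere (0 : F) 1, ⟪c, g (x c)⟫ ≤ r) : ∃ y, q y = z ∧ ‖g y‖ ≤ r := by
  obtain ⟨X, hXc, hXx, hXz⟩ := exists_continuousOn_extension_levelSet hFE hq hhom hpos hz hx hxz
  obtain ⟨c, hc, hc0⟩ := exists_zero_of_inner_nonpos (g := fun c => g (X c) - r • c)
    ((hg.comp_continuousOn hXc).sub (continuous_const.smul continuous_id).continuousOn)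
    fun c hc => by
      rw [hXx hc, inner_sub_right, real_inner_smul_right, real_inner_self_eq_norm_sq,
        mem_sphere_zero_iff_norm.1 hc, one_pow, mul_one, sub_nonpos]
      exact hgx c hc
  refine ⟨X c, hXz c hc, ?_⟩
  rw [sub_eq_zero.1 hc0, norm_smul, Real.norm_of_nonneg hr]
  exact mul_le_of_le_one_right hr (mem_closedBall_zero_iff.1 hc)

theorem exists_levelSet_norm_sub_le {W : Submodule ℝ F} [FiniteDimensional ℝ W]
    (hWE : finrank ℝ W < finrank ℝ E) (hq : Continuous q)
    (hhom : ∀ (t : ℝ) (y : E), q (t • y) = t ^ 2 * q y) (hpos : ∀ y, y ≠ 0 → 0 < q y) (hz : 0 < z)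
    {φ : E → F} (hφ : ContDiff ℝ 1 φ) {p : F} (hp : ∀ y, q y = z → φ y - p ∈ W) {N : E → ℝ}
    {κ : NNReal} (hκ : 0 < κ) {r : ℝ} (hr : 0 ≤ r)
    (hmin : ∀ c ∈ W, ‖c‖ = 1 → ∃ x, q x = z ∧ ⟪c, φ x - p⟫ ≤ r ∧
      ∀ u, q u = z → ⟪c, φ x⟫ + N x + κ * ‖u - x‖ ^ 2 ≤ ⟪c, φ u⟫ + N u) :
    ∃ y, q y = z ∧ ‖φ y - p‖ ≤ r := by
  choose! x hxz hxr hxmin using fun (c : W) (hc : c ∈ sphere (0 : W) 1) =>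
    hmin c c.2 (mem_sphere_zero_iff_norm.1 hc)
  let g : E → W := fun y => W.orthogonalProjectionOnto (φ y - p)
  have hinner (c : W) (y : E) : ⟪c, g y⟫ = ⟪(c : F), φ y - p⟫ :=
    W.inner_orthogonalProjectionOnto_eq_of_mem_left c (φ y - p)
  have hcomp : IsCompact {y | q y = z} := (isCompact_setOf_le hq hhom hpos z).of_isClosed_subset
    (isClosed_eq hq continuous_const) fun y hy => hy.le
  have hg : ContDiff ℝ 1 g := W.orthogonalProjectionOnto.contDiff.comp (hφ.sub contDiff_const)
  obtain ⟨L, hL⟩ :=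
    hg.locallyLipschitz.locallyLipschitzOn.exists_lipschitzOnWith_of_compact hcomp
  have hlip := lipschitzOnWith_of_forall_add_mul_sq_le hL hκ (fun c hc => hxz c hc)
    (N := N) fun c hc u hu => by
      have := hxmin c hc u hu
      simp only [hinner, inner_sub_right]
      linarith
  obtain ⟨y, hy, hyr⟩ := exists_levelSet_norm_le hWE hq hhom hpos hz hlip hxz hg.continuous hr
    fun c hc => (hinner c _).trans_le (hxr c hc)
  exact ⟨y, hy, (W.norm_orthogonalProjectionOnto_apply (hp y hy)).symm.trans_le hyr⟩

end LevelSet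

namespace QuadMap

section NormSqOf

variable {𝕜 : Type*} [RCLike 𝕜] {n : ℕ} {M P : Matrix (Fin n) (Fin n) 𝕜}

/-- The real inner product `Re (x^* y)` of `𝕜 ^ n` as a bilinear map, used for the linear part of
`quadMap` and to polarize `normSqOf`. -/
noncomputable def reDot : (Fin n → 𝕜) →ₗ[ℝ] (Fin n → 𝕜) →ₗ[ℝ] ℝ :=
  LinearMap.mk₂ ℝ (fun x y => RCLike.re (star x ⬝ᵥ y)) (by simp [add_dotProduct])
    (by simp [smul_dotProduct, RCLike.smul_re]) (by simp [dotProduct_add])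
    (by simp [dotProduct_smul, RCLike.smul_re])

theorem reDot_apply (x y : Fin n → 𝕜) : reDot x y = RCLike.re (star x ⬝ᵥ y) := rfl

theorem reDot_comm (x y : Fin n → 𝕜) : reDot x y = reDot y x := by
  rw [reDot_apply, reDot_apply, ← RCLike.conj_re (star x ⬝ᵥ y), starRingEnd_apply,
    ← Matrix.star_dotProduct_star, star_star, dotProduct_comm]

theorem reDot_ofReal_smul (r : ℝ) (x y : Fin n → 𝕜) : reDot x ((r : 𝕜) • y) = r * reDot x y := by
  rw [← RCLike.real_smul_eq_coe_smul, map_smul, smul_eq_mul]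

theorem reDot_mulVec_comm (hM : M.IsHermitian) (x y : Fin n → 𝕜) :
    reDot x (M *ᵥ y) = reDot y (M *ᵥ x) := by
  rw [reDot_comm y, reDot_apply, reDot_apply, Matrix.star_mulVec, hM.eq, Matrix.dotProduct_mulVec]

theorem normSqOf_eq_reDot (M : Matrix (Fin n) (Fin n) 𝕜) (x : Fin n → 𝕜) :
    normSqOf M x = reDot x (M *ᵥ x) := rfl

theorem normSqOf_add_matrix (M N : Matrix (Fin n) (Fin n) 𝕜) (x : Fin n → 𝕜) :
    normSqOf (M + N) x = normSqOf M x + normSqOf N x := by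
  simp only [normSqOf_eq_reDot, Matrix.add_mulVec, map_add]

theorem normSqOf_sub_matrix (M N : Matrix (Fin n) (Fin n) 𝕜) (x : Fin n → 𝕜) :
    normSqOf (M - N) x = normSqOf M x - normSqOf N x := by
  simp only [normSqOf_eq_reDot, Matrix.sub_mulVec, map_sub]

theorem normSqOf_ofReal_smul_matrix (r : ℝ) (M : Matrix (Fin n) (Fin n) 𝕜) (x : Fin n → 𝕜) :
    normSqOf ((r : 𝕜) • M) x = r * normSqOf M x := by
  simp only [normSqOf_eq_reDot, Matrix.smul_mulVec, reDot_ofReal_smul]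

theorem normSqOf_smul (M : Matrix (Fin n) (Fin n) 𝕜) (r : ℝ) (x : Fin n → 𝕜) :
    normSqOf M (r • x) = r ^ 2 * normSqOf M x := by
  simp only [normSqOf_eq_reDot, Matrix.mulVec_smul, map_smul, LinearMap.smul_apply, smul_eq_mul]
  ring

theorem normSqOf_zero (M : Matrix (Fin n) (Fin n) 𝕜) : normSqOf M 0 = 0 := by
  simp [normSqOf_eq_reDot]

theorem normSqOf_add (hM : M.IsHermitian) (x y : Fin n → 𝕜) :
    normSqOf M (x + y) = normSqOf M x + 2 * reDot y (M *ᵥ x) + normSqOf M y := by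
  simp only [normSqOf_eq_reDot, Matrix.mulVec_add, map_add, LinearMap.add_apply]
  rw [reDot_mulVec_comm hM x y]
  ring

theorem normSqOf_sub_two_mul_reDot (hM : M.IsHermitian) {y b : Fin n → 𝕜} (hy : M *ᵥ y = b)
    (u : Fin n → 𝕜) :
    normSqOf M u - 2 * reDot u b = normSqOf M y - 2 * reDot y b + normSqOf M (u - y) := by
  have hexpand := normSqOf_add hM y (u - y)
  rw [add_sub_cancel, hy, map_sub, LinearMap.sub_apply] at hexpand
  linarith

theorem continuous_normSqOf (M : Matrix (Fin n) (Fin n) 𝕜) : Continuous (normSqOf M) := by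
  unfold normSqOf
  fun_prop

theorem normSqOf_pos (hP : P.PosDef) {x : Fin n → 𝕜} (hx : x ≠ 0) : 0 < normSqOf P x :=
  (RCLike.pos_iff.1 (hP.dotProduct_mulVec_pos hx)).1

theorem normSqOf_nonneg (hP : P.PosSemidef) (x : Fin n → 𝕜) : 0 ≤ normSqOf P x :=
  (RCLike.nonneg_iff.1 (hP.dotProduct_mulVec_nonneg x)).1

theorem posSemidef_of_normSqOf_nonneg (hM : M.IsHermitian) (h : ∀ x, 0 ≤ normSqOf M x) :
    M.PosSemidef :=
  Matrix.PosSemidef.of_dotProduct_mulVec_nonneg hM fun x =>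
    RCLike.nonneg_iff.2 ⟨h x, hM.im_star_dotProduct_mulVec_self x⟩

theorem mulVec_eq_zero_of_normSqOf_eq_zero (hM : M.PosSemidef) {x : Fin n → 𝕜}
    (hx : normSqOf M x = 0) : M *ᵥ x = 0 :=
  (hM.dotProduct_mulVec_zero_iff x).1 <| RCLike.ext (hx.trans (map_zero _).symm) <| by
    rw [hM.isHermitian.im_star_dotProduct_mulVec_self, map_zero]

theorem posSemidef_sub_minGenEig_smul (hP : P.PosDef) (hM : M.IsHermitian) :
    (M - (minGenEig P M : 𝕜) • P).PosSemidef := by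
  have hherm (l : ℝ) : (M - (l : 𝕜) • P).IsHermitian :=
    hM.sub (hP.isHermitian.smul (RCLike.conj_ofReal l))
  have hsub (l : ℝ) (x : Fin n → 𝕜) :
      normSqOf (M - (l : 𝕜) • P) x = normSqOf M x - l * normSqOf P x := by
    rw [normSqOf_sub_matrix, normSqOf_ofReal_smul_matrix]
  rcases subsingleton_or_nontrivial (Fin n → 𝕜) with hE | hE
  · exact posSemidef_of_normSqOf_nonneg (hherm _) fun x => by
      rw [Subsingleton.elim x 0, normSqOf_zero]
  obtain ⟨y₀, hy₀, hle⟩ := exists_forall_div_mul_le (continuous_normSqOf P) (normSqOf_smul P)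
    (fun y => normSqOf_pos hP) (continuous_normSqOf M) (normSqOf_smul M)
  set μ := normSqOf M y₀ / normSqOf P y₀ with hμ
  have hpsd : (M - (μ : 𝕜) • P).PosSemidef :=
    posSemidef_of_normSqOf_nonneg (hherm μ) fun x => by
      rw [hsub, sub_nonneg]
      exact hle x
  have hleast : IsLeast {l : ℝ | ∃ x : Fin n → 𝕜, x ≠ 0 ∧ (M - (l : 𝕜) • P) *ᵥ x = 0} μ := by
    refine ⟨⟨y₀, hy₀, mulVec_eq_zero_of_normSqOf_eq_zero hpsd ?_⟩, ?_⟩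
    · rw [hsub, hμ, div_mul_cancel₀ _ (normSqOf_pos hP hy₀).ne', sub_self]
    · rintro l ⟨x, hx, hx0⟩
      have hl := hsub l x
      rw [normSqOf_eq_reDot, hx0, map_zero] at hl
      exact le_of_mul_le_mul_right (by linarith [hle x]) (normSqOf_pos hP hx)
  rwa [minGenEig, hleast.csInf_eq]

end NormSqOf

section Multiplier

variable {𝕜 : Type*} [RCLike 𝕜] {n : ℕ} {P T : Matrix (Fin n) (Fin n) 𝕜}

theorem mulVec_inv_mulVec {R ι : Type*} [CommRing R] [Fintype ι] [DecidableEq ι]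
    {M : Matrix ι ι R} (hM : IsUnit M) (b : ι → R) : M *ᵥ (M⁻¹ *ᵥ b) = b := by
  rw [Matrix.mulVec_mulVec, Matrix.mul_nonsing_inv _ ((Matrix.isUnit_iff_isUnit_det _).1 hM),
    Matrix.one_mulVec]

theorem posDef_add_ofReal_smul (hT : T.PosDef) (hP : P.PosDef) {s : ℝ} (hs : 0 ≤ s) :
    (T + (s : 𝕜) • P).PosDef :=
  hT.add_posSemidef (hP.posSemidef.smul (RCLike.ofReal_nonneg.2 hs))

theorem continuousOn_normSqOf_inv_mulVec (hT : T.PosDef) (hP : P.PosDef) (b : Fin n → 𝕜) :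
    ContinuousOn (fun s : ℝ => normSqOf P ((T + (s : 𝕜) • P)⁻¹ *ᵥ b)) (Set.Ici 0) := by
  intro s hs
  have hdet : (T + (s : 𝕜) • P).det ≠ 0 :=
    ((Matrix.isUnit_iff_isUnit_det _).1 (posDef_add_ofReal_smul hT hP hs).isUnit).ne_zero
  have hinv : ContinuousAt Ring.inverse (T + (s : 𝕜) • P).det := by
    rw [Ring.inverse_eq_inv']
    exact continuousAt_inv₀ hdet
  have hcoe : Continuous fun s : ℝ => (s : 𝕜) := RCLike.continuous_ofReal
  have hpencil : Continuous fun s : ℝ => T + (s : 𝕜) • P :=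
    continuous_const.add (hcoe.smul continuous_const)
  have hmul : Continuous fun R : Matrix (Fin n) (Fin n) 𝕜 => normSqOf P (R *ᵥ b) :=
    (continuous_normSqOf P).comp (continuous_id.matrix_mulVec continuous_const)
  have hpencil_inv : ContinuousAt (fun s : ℝ => (T + (s : 𝕜) • P)⁻¹) s :=
    (continuousAt_matrix_inv _ hinv).comp (f := fun s : ℝ => T + (s : 𝕜) • P) hpencil.continuousAt
  exact (hmul.continuousAt.comp hpencil_inv).continuousWithinAt

theorem two_mul_sub_one_mul_normSqOf_le (hT : T.PosSemidef) (hP : P.PosDef) {s : ℝ}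
    {w y b : Fin n → 𝕜} (hy : (T + (s : 𝕜) • P) *ᵥ y = b) (hw : P *ᵥ w = b) :
    (2 * s - 1) * normSqOf P y ≤ normSqOf P w := by
  have hyb : normSqOf T y + s * normSqOf P y = reDot y b := by
    rw [← normSqOf_ofReal_smul_matrix, ← normSqOf_add_matrix, normSqOf_eq_reDot, hy]
  have hwb : normSqOf P w = reDot w b := by rw [normSqOf_eq_reDot, hw]
  have hsquare := normSqOf_sub_two_mul_reDot hP.isHermitian hw y
  have hdiff := normSqOf_nonneg hP.posSemidef (y - w)
  have hTy := normSqOf_nonneg hT y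
  linarith

theorem exists_lagrangeMultiplier (hT : T.PosDef) (hP : P.PosDef) (b : Fin n → 𝕜) {z : ℝ}
    (hz : 0 < z) (hzT : z ≤ normSqOf P (T⁻¹ *ᵥ b)) :
    ∃ s : ℝ, 0 ≤ s ∧ ∃ y, (T + (s : 𝕜) • P) *ᵥ y = b ∧ normSqOf P y = z := by
  have hsol {s : ℝ} (hs : 0 ≤ s) := mulVec_inv_mulVec (posDef_add_ofReal_smul hT hP hs).isUnit b
  set C : ℝ := normSqOf P (P⁻¹ *ᵥ b)
  have hC : 0 ≤ C / z := div_nonneg (normSqOf_nonneg hP.posSemidef _) hz.le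
  set S : ℝ := (C / z + 3) / 2 with hS
  have hS0 : 0 ≤ S := by positivity
  have hlarge : normSqOf P ((T + (S : 𝕜) • P)⁻¹ *ᵥ b) ≤ z := by
    have hbound := two_mul_sub_one_mul_normSqOf_le hT.posSemidef hP (hsol hS0)
      (mulVec_inv_mulVec hP.isUnit b)
    have hC_eq : C = C / z * z := (div_mul_cancel₀ C hz.ne').symm
    refine le_of_mul_le_mul_left (hbound.trans ?_) (show 0 < 2 * S - 1 by linarith)
    linear_combination hC_eq + 2 * hz.le + z * hS * (-2)
  obtain ⟨s, hs, hsz⟩ := intermediate_value_Icc' hS0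
    ((continuousOn_normSqOf_inv_mulVec hT hP b).mono Set.Icc_subset_Ici_self)
    ⟨hlarge, by simpa using hzT⟩
  exact ⟨s, hs.1, _, hsol hs.1, hsz⟩

end Multiplier

section CenteredMap

open RealInnerProductSpace

variable {𝕜 : Type*} [RCLike 𝕜] {m n : ℕ} {A : Fin m → Matrix (Fin n) (Fin n) 𝕜}
  {v : Fin m → Fin n → 𝕜} {f0 cp : Fin m → ℝ}

theorem isHermitian_combMat (hA : ∀ i, (A i).IsHermitian) (c : Fin m → ℝ) :
    (combMat c A).IsHermitian :=
  isSelfAdjoint_sum _ fun i _ => (hA i).smul (RCLike.conj_ofReal (c i))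

theorem combVec_eq_linearCombination (c : Fin m → ℝ) (v : Fin m → Fin n → 𝕜) :
    combVec c v = Fintype.linearCombination ℝ v c := by
  simp only [combVec, Fintype.linearCombination_apply, RCLike.real_smul_eq_coe_smul (K := 𝕜)]

theorem combVec_sub_mulVec (c : Fin m → ℝ) (A : Fin m → Matrix (Fin n) (Fin n) 𝕜)
    (v : Fin m → Fin n → 𝕜) (x : Fin n → 𝕜) :
    combVec c (fun i => v i - A i *ᵥ x) = combVec c v - combMat c A *ᵥ x := by
  simp only [combVec, combMat, smul_sub, Finset.sum_sub_distrib, Matrix.sum_mulVec,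
    Matrix.smul_mulVec]

theorem quadMap_apply (A : Fin m → Matrix (Fin n) (Fin n) 𝕜) (v : Fin m → Fin n → 𝕜)
    (f0 : Fin m → ℝ) (x : Fin n → 𝕜) (i : Fin m) :
    quadMap A v f0 x i = normSqOf (A i) x - 2 * reDot x (v i) + f0 i := by
  rw [quadMap, map_sub, map_sub, ← reDot_apply, ← reDot_apply, ← reDot_apply, reDot_comm (v i),
    normSqOf_eq_reDot]
  ring

theorem dotProduct_quadMap (A : Fin m → Matrix (Fin n) (Fin n) 𝕜) (v : Fin m → Fin n → 𝕜)
    (f0 c : Fin m → ℝ) (x : Fin n → 𝕜) :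
    c ⬝ᵥ quadMap A v f0 x = normSqOf (combMat c A) x - 2 * reDot x (combVec c v) + c ⬝ᵥ f0 := by
  simp only [dotProduct, quadMap_apply, normSqOf_eq_reDot, combMat, combVec, Matrix.sum_mulVec,
    Matrix.smul_mulVec, map_sum, reDot_ofReal_smul, mul_add, mul_sub, Finset.sum_add_distrib,
    Finset.sum_sub_distrib, Finset.mul_sum, mul_left_comm]

theorem dotProduct_quadMap_add (hA : ∀ i, (A i).IsHermitian) (v : Fin m → Fin n → 𝕜)
    (f0 c : Fin m → ℝ) (x y : Fin n → 𝕜) :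
    c ⬝ᵥ quadMap A v f0 (x + y) = c ⬝ᵥ quadMap A v f0 x +
      (normSqOf (combMat c A) y - 2 * reDot y (combVec c fun i => v i - A i *ᵥ x)) := by
  rw [dotProduct_quadMap, dotProduct_quadMap, combVec_sub_mulVec,
    normSqOf_add (isHermitian_combMat hA c), map_add, LinearMap.add_apply, map_sub]
  ring

theorem dotProduct_quadMap_basePoint_add (hA : ∀ i, (A i).IsHermitian) (v : Fin m → Fin n → 𝕜)
    (f0 : Fin m → ℝ) (hpos : (combMat cp A).PosDef) (y : Fin n → 𝕜) :
    cp ⬝ᵥ quadMap A v f0 (basePoint A v cp + y) =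
      cp ⬝ᵥ quadMap A v f0 (basePoint A v cp) + normSqOf (combMat cp A) y := by
  have hcrit : combMat cp A *ᵥ basePoint A v cp = combVec cp v := mulVec_inv_mulVec hpos.isUnit _
  rw [dotProduct_quadMap_add hA, combVec_sub_mulVec, hcrit, sub_self, map_zero, mul_zero, sub_zero]

theorem contDiff_quadMap {k : WithTop ℕ∞} (A : Fin m → Matrix (Fin n) (Fin n) 𝕜)
    (v : Fin m → Fin n → 𝕜) (f0 : Fin m → ℝ) : ContDiff ℝ k (quadMap A v f0) := by
  have hstar : ContDiff ℝ k (fun x : 𝕜 => star x) := (RCLike.conjCLE (K := 𝕜)).contDiff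
  have hre : ContDiff ℝ k (fun x : 𝕜 => RCLike.re x) := (RCLike.reCLM (K := 𝕜)).contDiff
  refine contDiff_pi.2 fun i => ?_
  simp only [quadMap, dotProduct, Matrix.mulVec, Pi.star_apply]
  fun_prop

/-- The quadratic map in the coordinate `y = x - x₀` centred at the base point, with values in
Euclidean space so that inner products with `c` are the combinations `c · f`. -/
noncomputable def centeredMap (A : Fin m → Matrix (Fin n) (Fin n) 𝕜) (v : Fin m → Fin n → 𝕜)
    (f0 cp : Fin m → ℝ) (y : Fin n → 𝕜) : EuclideanSpace ℝ (Fin m) :=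
  WithLp.toLp 2 (quadMap A v f0 (basePoint A v cp + y))

theorem contDiff_centeredMap {k : WithTop ℕ∞} (A : Fin m → Matrix (Fin n) (Fin n) 𝕜)
    (v : Fin m → Fin n → 𝕜) (f0 cp : Fin m → ℝ) : ContDiff ℝ k (centeredMap A v f0 cp) :=
  (PiLp.continuousLinearEquiv 2 ℝ (fun _ : Fin m => ℝ)).symm.contDiff.comp
    ((contDiff_quadMap A v f0).comp (contDiff_const.add contDiff_id))

theorem real_inner_eq_dotProduct (c d : EuclideanSpace ℝ (Fin m)) :
    ⟪c, d⟫ = c.ofLp ⬝ᵥ d.ofLp := by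
  rw [EuclideanSpace.inner_eq_star_dotProduct, dotProduct_comm, star_trivial]

theorem exists_penalized_minimizer (hA : ∀ i, (A i).IsHermitian) (f0 : Fin m → ℝ)
    (hpos : (combMat cp A).PosDef) {ε z : ℝ} (hε : 0 < ε) (hz : 0 < z)
    {c : EuclideanSpace ℝ (Fin m)} (hc : z ≤ objective A v cp ε c) :
    ∃ (y : Fin n → 𝕜) (l : ℝ), normSqOf (combMat cp A) y = z ∧ ∀ u : Fin n → 𝕜,
      ⟪c, centeredMap A v f0 cp y⟫ + ε * normSqOf 1 y - l * z + ε * normSqOf 1 (u - y) ≤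
        ⟪c, centeredMap A v f0 cp u⟫ + ε * normSqOf 1 u - l * normSqOf (combMat cp A) u := by
  set P := combMat cp A
  set μ := minGenEig P (combMat c A)
  set T : Matrix (Fin n) (Fin n) 𝕜 := combMat c A - (μ : 𝕜) • P + (ε : 𝕜) • 1 with hT
  have hpsd : (combMat c A - (μ : 𝕜) • P).PosSemidef :=
    posSemidef_sub_minGenEig_smul hpos (isHermitian_combMat hA c)
  have hTpos : T.PosDef :=
    Matrix.PosDef.posSemidef_add hpsd (Matrix.PosDef.one.smul (RCLike.ofReal_pos.2 hε))
  have hTnorm (u : Fin n → 𝕜) : normSqOf T u =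
      normSqOf (combMat c A) u - μ * normSqOf P u + ε * normSqOf 1 u := by
    rw [hT, normSqOf_add_matrix, normSqOf_sub_matrix, normSqOf_ofReal_smul_matrix,
      normSqOf_ofReal_smul_matrix]
  have hTle (u : Fin n → 𝕜) : ε * normSqOf 1 u ≤ normSqOf T u := by
    rw [hT, normSqOf_add_matrix, normSqOf_ofReal_smul_matrix]
    exact le_add_of_nonneg_left (normSqOf_nonneg hpsd u)
  obtain ⟨s, hs, y, hy, hyz⟩ := exists_lagrangeMultiplier hTpos hpos
    (combVec c fun i => v i - A i *ᵥ basePoint A v cp) hz hc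
  refine ⟨y, μ - s, hyz, fun u => ?_⟩
  have hsquare :=
    normSqOf_sub_two_mul_reDot (posDef_add_ofReal_smul hTpos hpos hs).isHermitian hy u
  have hPdiff := mul_nonneg hs (normSqOf_nonneg hpos.posSemidef (u - y))
  simp only [normSqOf_add_matrix T, normSqOf_ofReal_smul_matrix s, hTnorm u, hTnorm y, hyz]
    at hsquare
  simp only [real_inner_eq_dotProduct, centeredMap, dotProduct_quadMap_add hA]
  linarith [hTle (u - y)]

/-- The orthogonal complement of `c₊`, whose unit sphere is the set `𝒞` in the definition of
`z_max`. -/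
noncomputable abbrev coeffSpace (cp : Fin m → ℝ) : Submodule ℝ (EuclideanSpace ℝ (Fin m)) :=
  (ℝ ∙ WithLp.toLp 2 cp)ᗮ

theorem mem_coeffSpace {c : EuclideanSpace ℝ (Fin m)} :
    c ∈ coeffSpace cp ↔ c.ofLp ⬝ᵥ cp = 0 := by
  rw [Submodule.mem_orthogonal_singleton_iff_inner_left, real_inner_eq_dotProduct]

theorem finrank_coeffSpace_add_one (hcp : cp ≠ 0) :
    Module.finrank ℝ (coeffSpace cp) + 1 = m := by
  have h := Submodule.finrank_add_finrank_orthogonal (ℝ ∙ (WithLp.toLp 2 cp))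
  rwa [finrank_span_singleton (by simpa using hcp), finrank_euclideanSpace_fin, add_comm] at h

theorem minObjective_le {c : EuclideanSpace ℝ (Fin m)} (hc : c ∈ coeffSpace cp) (hc1 : ‖c‖ = 1)
    (ε : ℝ) : minObjective A v cp ε ≤ ENNReal.ofReal (objective A v cp ε c) := by
  refine iInf₂_le (i := c.ofLp) ⟨?_, mem_coeffSpace.1 hc⟩
  rw [← real_inner_eq_dotProduct, real_inner_self_eq_norm_sq, hc1, one_pow]

theorem zMax_eq_zero {c : EuclideanSpace ℝ (Fin m)} (hc : c ∈ coeffSpace cp) (hc1 : ‖c‖ = 1)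
    (h : combVec c (fun i => v i - A i *ᵥ basePoint A v cp) = 0) : zMax A v cp = 0 := by
  have hzero (ε : ℝ) : minObjective A v cp ε = 0 := by
    refine le_antisymm ((minObjective_le hc hc1 ε).trans ?_) zero_le
    rw [objective, h, Matrix.mulVec_zero, normSqOf_zero, ENNReal.ofReal_zero]
  simp only [zMax, hzero, Filter.limsup_const]

theorem finrank_coeffSpace_lt (hcp : cp ≠ 0) (hdim : Module.finrank ℝ (Fin n → 𝕜) + 1 ≠ m)
    (hz : zMax A v cp ≠ 0) :
    Module.finrank ℝ (coeffSpace cp) < Module.finrank ℝ (Fin n → 𝕜) := by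
  let B : coeffSpace cp →ₗ[ℝ] (Fin n → 𝕜) :=
    Fintype.linearCombination ℝ (fun i => v i - A i *ᵥ basePoint A v cp) ∘ₗ
      (WithLp.linearEquiv 2 ℝ (Fin m → ℝ)).toLinearMap ∘ₗ (coeffSpace cp).subtype
  have hB : Function.Injective B := (injective_iff_map_eq_zero B).2 fun c hc => by
    by_contra hne
    have hunit : B (‖c‖⁻¹ • c) = 0 := by rw [map_smul, hc, smul_zero]
    have hnorm : ‖‖c‖⁻¹ • c‖ = 1 := norm_smul_inv_norm (𝕜 := ℝ) hne
    exact hz (zMax_eq_zero (‖c‖⁻¹ • c).2 hnorm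
      ((combVec_eq_linearCombination _ _).trans hunit))
  have hle := LinearMap.finrank_le_finrank_of_injective hB
  have hfin := finrank_coeffSpace_add_one hcp
  omega

theorem frequently_forall_le_objective {z : ℝ} (hz : ENNReal.ofReal z < zMax A v cp) :
    ∃ᶠ ε in 𝓝[>] (0 : ℝ), ∀ c ∈ coeffSpace cp, ‖c‖ = 1 → z ≤ objective A v cp ε c := by
  refine (Filter.frequently_lt_of_lt_limsup (by isBoundedDefault) hz).mono fun ε hε c hc hc1 => ?_
  exact (ENNReal.ofReal_lt_ofReal_iff'.1 (hε.trans_le (minObjective_le hc hc1 ε))).1.le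

end CenteredMap

section Convexity

open RealInnerProductSpace

variable {𝕜 : Type*} [RCLike 𝕜] {m n : ℕ} {A : Fin m → Matrix (Fin n) (Fin n) 𝕜}
  {v : Fin m → Fin n → 𝕜} {f0 cp : Fin m → ℝ}

theorem centeredMap_sub_combination_mem_coeffSpace (hA : ∀ i, (A i).IsHermitian)
    (v : Fin m → Fin n → 𝕜) (f0 : Fin m → ℝ) (hpos : (combMat cp A).PosDef)
    {y y₁ y₂ : Fin n → 𝕜} {a b : ℝ} (hab : a + b = 1)
    (hy : normSqOf (combMat cp A) y =
      a * normSqOf (combMat cp A) y₁ + b * normSqOf (combMat cp A) y₂) :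
    centeredMap A v f0 cp y - (a • centeredMap A v f0 cp y₁ + b • centeredMap A v f0 cp y₂) ∈
      coeffSpace cp := by
  rw [Submodule.mem_orthogonal_singleton_iff_inner_right]
  simp only [inner_sub_right, inner_add_right, real_inner_smul_right, real_inner_eq_dotProduct,
    centeredMap, dotProduct_quadMap_basePoint_add hA v f0 hpos]
  linear_combination hy - (cp ⬝ᵥ quadMap A v f0 (basePoint A v cp)) * hab

theorem inner_centeredMap_sub_combination_le {c : EuclideanSpace ℝ (Fin m)} {ε l z : ℝ}
    (hε : 0 ≤ ε) {y y₁ y₂ : Fin n → 𝕜} {a b : ℝ} (ha : 0 ≤ a) (hb : 0 ≤ b) (hab : a + b = 1)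
    (hz : a * normSqOf (combMat cp A) y₁ + b * normSqOf (combMat cp A) y₂ = z)
    (hmin : ∀ u : Fin n → 𝕜,
      ⟪c, centeredMap A v f0 cp y⟫ + ε * normSqOf 1 y - l * z + ε * normSqOf 1 (u - y) ≤
        ⟪c, centeredMap A v f0 cp u⟫ + ε * normSqOf 1 u - l * normSqOf (combMat cp A) u) :
    ⟪c, centeredMap A v f0 cp y -
        (a • centeredMap A v f0 cp y₁ + b • centeredMap A v f0 cp y₂)⟫ ≤
      ε * (a * normSqOf 1 y₁ + b * normSqOf 1 y₂) := by
  have hpenalty (u : Fin n → 𝕜) : 0 ≤ ε * normSqOf 1 u :=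
    mul_nonneg hε (normSqOf_nonneg Matrix.PosSemidef.one u)
  have hmin' (u : Fin n → 𝕜) : ⟪c, centeredMap A v f0 cp y⟫ - l * z ≤
      ⟪c, centeredMap A v f0 cp u⟫ + ε * normSqOf 1 u - l * normSqOf (combMat cp A) u := by
    linarith [hmin u, hpenalty y, hpenalty (u - y)]
  simp only [inner_sub_right, inner_add_right, real_inner_smul_right]
  linear_combination a * hmin' y₁ + b * hmin' y₂ - l * hz +
    (l * z - ⟪c, centeredMap A v f0 cp y⟫) * hab

theorem exists_norm_centeredMap_sub_combination_le (hA : ∀ i, (A i).IsHermitian) (f0 : Fin m → ℝ)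
    (hpos : (combMat cp A).PosDef)
    (hlt : Module.finrank ℝ (coeffSpace cp) < Module.finrank ℝ (Fin n → 𝕜))
    {ε z : ℝ} (hε : 0 < ε) (hz : 0 < z)
    (hobj : ∀ c ∈ coeffSpace cp, ‖c‖ = 1 → z ≤ objective A v cp ε c)
    {y₁ y₂ : Fin n → 𝕜} {a b : ℝ} (ha : 0 ≤ a) (hb : 0 ≤ b) (hab : a + b = 1)
    (hyz : a * normSqOf (combMat cp A) y₁ + b * normSqOf (combMat cp A) y₂ = z) :
    ∃ y, normSqOf (combMat cp A) y = z ∧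
      ‖centeredMap A v f0 cp y -
          (a • centeredMap A v f0 cp y₁ + b • centeredMap A v f0 cp y₂)‖ ≤
        ε * (a * normSqOf 1 y₁ + b * normSqOf 1 y₂) := by
  have hone (u : Fin n → 𝕜) : 0 ≤ normSqOf 1 u := normSqOf_nonneg Matrix.PosSemidef.one u
  obtain ⟨δ, hδ, hδle⟩ := exists_pos_forall_mul_norm_sq_le
    (continuous_normSqOf (1 : Matrix (Fin n) (Fin n) 𝕜)) (normSqOf_smul 1)
    fun y => normSqOf_pos Matrix.PosDef.one
  refine exists_levelSet_norm_sub_le hlt (continuous_normSqOf _) (normSqOf_smul _)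
    (fun y => normSqOf_pos hpos) hz (contDiff_centeredMap A v f0 cp)
    (fun y hy => centeredMap_sub_combination_mem_coeffSpace hA v f0 hpos hab (hy.trans hyz.symm))
    (N := fun u => ε * normSqOf 1 u) (κ := .mk (ε * δ) (by positivity)) (mul_pos hε hδ)
    (mul_nonneg hε.le (add_nonneg (mul_nonneg ha (hone y₁)) (mul_nonneg hb (hone y₂))))
    fun c hc hc1 => ?_
  obtain ⟨x, l, hxz, hmin⟩ := exists_penalized_minimizer hA f0 hpos hε hz (hobj c hc hc1)
  refine ⟨x, hxz, inner_centeredMap_sub_combination_le hε.le ha hb hab hyz hmin, fun u hu => ?_⟩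
  have hux := hmin u
  have hgrowth : ε * δ * ‖u - x‖ ^ 2 ≤ ε * normSqOf 1 (u - x) := by
    rw [mul_assoc]
    exact mul_le_mul_of_nonneg_left (hδle _) hε.le
  rw [hu] at hux
  rw [NNReal.coe_mk]
  linarith

theorem exists_centeredMap_eq_combination (hA : ∀ i, (A i).IsHermitian) (f0 : Fin m → ℝ)
    (hcp : cp ≠ 0) (hpos : (combMat cp A).PosDef) (hdim : Module.finrank ℝ (Fin n → 𝕜) + 1 ≠ m)
    {z : ℝ} (hz : 0 < z) (hzmax : ENNReal.ofReal z < zMax A v cp) {y₁ y₂ : Fin n → 𝕜} {a b : ℝ}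
    (ha : 0 ≤ a) (hb : 0 ≤ b) (hab : a + b = 1)
    (hyz : a * normSqOf (combMat cp A) y₁ + b * normSqOf (combMat cp A) y₂ = z) :
    ∃ y, normSqOf (combMat cp A) y = z ∧ centeredMap A v f0 cp y =
      a • centeredMap A v f0 cp y₁ + b • centeredMap A v f0 cp y₂ := by
  set p := a • centeredMap A v f0 cp y₁ + b • centeredMap A v f0 cp y₂
  have hlt := finrank_coeffSpace_lt hcp hdim (zero_le.trans_lt hzmax).ne'
  have hlevel : IsCompact {y : Fin n → 𝕜 | normSqOf (combMat cp A) y = z} :=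
    (isCompact_setOf_le (continuous_normSqOf _) (normSqOf_smul _) (fun y => normSqOf_pos hpos)
      z).of_isClosed_subset (isClosed_eq (continuous_normSqOf _) continuous_const) fun y hy => hy.le
  have hclosed := (hlevel.image (contDiff_centeredMap (k := 0) A v f0 cp).continuous).isClosed
  suffices hmem : p ∈ closure (centeredMap A v f0 cp '' {y | normSqOf (combMat cp A) y = z}) by
    rw [hclosed.closure_eq] at hmem
    exact hmem
  refine Metric.mem_closure_iff.2 fun η hη => ?_
  set R : ℝ := a * normSqOf 1 y₁ + b * normSqOf 1 y₂
  have hlim : Filter.Tendsto (fun ε : ℝ => ε * R) (𝓝[>] 0) (𝓝 (0 * R)) :=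
    ((continuous_mul_const R).tendsto 0).mono_left nhdsWithin_le_nhds
  have hsmall : ∀ᶠ ε in 𝓝[>] (0 : ℝ), 0 < ε ∧ ε * R < η :=
    eventually_mem_nhdsWithin.and (hlim.eventually_lt_const (by rwa [zero_mul]))
  obtain ⟨ε, hobj, hε, hεη⟩ :=
    ((frequently_forall_le_objective hzmax).and_eventually hsmall).exists
  obtain ⟨y, hy, hyp⟩ := exists_norm_centeredMap_sub_combination_le hA f0 hpos hlt hε hz hobj ha hb
    hab hyz
  refine ⟨_, ⟨y, hy, rfl⟩, ?_⟩
  rw [dist_comm, dist_eq_norm]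
  exact hyp.trans_lt hεη

theorem convex_image_centeredMap (hA : ∀ i, (A i).IsHermitian) (v : Fin m → Fin n → 𝕜)
    (f0 : Fin m → ℝ) (hcp : cp ≠ 0) (hpos : (combMat cp A).PosDef)
    (hdim : Module.finrank ℝ (Fin n → 𝕜) + 1 ≠ m) :
    Convex ℝ (centeredMap A v f0 cp ''
      {y | ENNReal.ofReal (normSqOf (combMat cp A) y) < zMax A v cp}) := by
  rw [convex_iff_forall_pos]
  rintro _ ⟨y₁, hy₁, rfl⟩ _ ⟨y₂, hy₂, rfl⟩ a b ha hb hab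
  set z := a * normSqOf (combMat cp A) y₁ + b * normSqOf (combMat cp A) y₂
  have hq₁ := mul_nonneg ha.le (normSqOf_nonneg hpos.posSemidef y₁)
  have hq₂ := mul_nonneg hb.le (normSqOf_nonneg hpos.posSemidef y₂)
  have hzmax : ENNReal.ofReal z < zMax A v cp := by
    refine (ENNReal.ofReal_mono (Convex.combo_le_max _ _ ha.le hb.le hab)).trans_lt ?_
    rw [ENNReal.ofReal_mono.map_max]
    exact max_lt hy₁ hy₂
  rcases (add_nonneg hq₁ hq₂).eq_or_lt with hz0 | hz0
  · have hzero {r : ℝ} (hr : 0 < r) {y : Fin n → 𝕜} (h : r * normSqOf (combMat cp A) y = 0) :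
        y = 0 := by
      by_contra hy
      exact (mul_pos hr (normSqOf_pos hpos hy)).ne' h
    rw [hzero ha (y := y₁) (by linarith), hzero hb (y := y₂) (by linarith), ← add_smul, hab,
      one_smul]
    exact ⟨0, by rwa [← hzero ha (y := y₁) (by linarith)], rfl⟩
  · obtain ⟨y, hyz, hy⟩ := exists_centeredMap_eq_combination hA f0 hcp hpos hdim hz0 hzmax ha.le
      hb.le hab rfl
    exact ⟨y, by rwa [Set.mem_ofPred_eq, hyz], hy⟩

theorem image_quadMap_basePoint_add (A : Fin m → Matrix (Fin n) (Fin n) 𝕜) (v : Fin m → Fin n → 𝕜)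
    (f0 cp : Fin m → ℝ) (s : Set (Fin n → 𝕜)) :
    quadMap A v f0 '' {x | x - basePoint A v cp ∈ s} =
      WithLp.linearEquiv 2 ℝ (Fin m → ℝ) '' (centeredMap A v f0 cp '' s) := by
  ext p
  constructor
  · rintro ⟨x, hx, rfl⟩
    exact ⟨_, ⟨_, hx, rfl⟩, by simp [centeredMap]⟩
  · rintro ⟨_, ⟨y, hy, rfl⟩, rfl⟩
    exact ⟨basePoint A v cp + y, by simpa using hy, rfl⟩

theorem cutImage_eq_image (htop : zMax A v cp ≠ ⊤) :
    cutImage A v f0 cp = WithLp.linearEquiv 2 ℝ (Fin m → ℝ) ''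
      (centeredMap A v f0 cp '' {y | normSqOf (combMat cp A) y ≤ (zMax A v cp).toReal}) := by
  rw [← image_quadMap_basePoint_add, cutImage]
  simp only [ENNReal.ofReal_le_iff_le_toReal htop, Set.mem_ofPred_eq]

theorem cutImage_eq_range (htop : zMax A v cp = ⊤) :
    cutImage A v f0 cp = Set.range (quadMap A v f0) := by
  simp only [cutImage, htop, le_top, Set.ofPred_true, Set.image_univ]

theorem cutImage_eq_inter (hA : ∀ i, (A i).IsHermitian) (v : Fin m → Fin n → 𝕜) (f0 : Fin m → ℝ)
    (hpos : (combMat cp A).PosDef) (htop : zMax A v cp ≠ ⊤) :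
    cutImage A v f0 cp = Set.range (quadMap A v f0) ∩
      {y | cp ⬝ᵥ y ≤ cp ⬝ᵥ quadMap A v f0 (basePoint A v cp) + (zMax A v cp).toReal} := by
  rw [← Set.image_preimage_eq_range_inter, cutImage]
  congr 1
  ext x
  have hx := dotProduct_quadMap_basePoint_add hA v f0 hpos (x - basePoint A v cp)
  rw [add_sub_cancel] at hx
  simp only [Set.mem_preimage, Set.mem_ofPred_eq, ENNReal.ofReal_le_iff_le_toReal htop, hx,
    add_le_add_iff_left]

theorem isCompact_cutImage (hpos : (combMat cp A).PosDef) (htop : zMax A v cp ≠ ⊤) :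
    IsCompact (cutImage A v f0 cp) := by
  rw [cutImage_eq_image htop]
  exact ((isCompact_setOf_le (continuous_normSqOf _) (normSqOf_smul _) (fun y => normSqOf_pos hpos)
    _).image (contDiff_centeredMap (k := 0) A v f0 cp).continuous).image (PiLp.continuous_ofLp 2 _)

theorem convex_range_of_zMax_eq_top (hA : ∀ i, (A i).IsHermitian) (v : Fin m → Fin n → 𝕜)
    (f0 : Fin m → ℝ) (hcp : cp ≠ 0) (hpos : (combMat cp A).PosDef)
    (hdim : Module.finrank ℝ (Fin n → 𝕜) + 1 ≠ m) (htop : zMax A v cp = ⊤) :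
    Convex ℝ (Set.range (quadMap A v f0)) := by
  have hconv := (convex_image_centeredMap hA v f0 hcp hpos hdim).linear_image
    (WithLp.linearEquiv 2 ℝ (Fin m → ℝ)).toLinearMap
  simp only [htop, ENNReal.ofReal_lt_top] at hconv
  rw [← Set.image_univ]
  exact (image_quadMap_basePoint_add A v f0 cp Set.univ).symm ▸ hconv

theorem convex_image_centeredMap_le (hA : ∀ i, (A i).IsHermitian) (v : Fin m → Fin n → 𝕜)
    (f0 : Fin m → ℝ) (hcp : cp ≠ 0) (hpos : (combMat cp A).PosDef)
    (hdim : Module.finrank ℝ (Fin n → 𝕜) + 1 ≠ m) (htop : zMax A v cp ≠ ⊤) :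
    Convex ℝ (centeredMap A v f0 cp ''
      {y | normSqOf (combMat cp A) y ≤ (zMax A v cp).toReal}) := by
  rcases (ENNReal.toReal_nonneg : 0 ≤ (zMax A v cp).toReal).eq_or_lt with hz | hz
  · have hzero {y : Fin n → 𝕜} (hy : normSqOf (combMat cp A) y ≤ (zMax A v cp).toReal) : y = 0 := by
      by_contra hne
      exact (normSqOf_pos hpos hne).not_ge (hy.trans_eq hz.symm)
    have hsub : {y | normSqOf (combMat cp A) y ≤ (zMax A v cp).toReal}.Subsingleton :=
      fun y hy y' hy' => (hzero hy).trans (hzero hy').symm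
    exact (hsub.image _).convex
  · have hcont := (contDiff_centeredMap (k := 0) A v f0 cp).continuous
    have hclosed := ((isCompact_setOf_le (continuous_normSqOf _) (normSqOf_smul _)
      (fun y => normSqOf_pos hpos) (zMax A v cp).toReal).image hcont).isClosed
    have hconv := (convex_image_centeredMap hA v f0 hcp hpos hdim).closure
    simp only [ENNReal.ofReal_lt_iff_lt_toReal (normSqOf_nonneg hpos.posSemidef _) htop] at hconv
    have hmono : {y | normSqOf (combMat cp A) y < (zMax A v cp).toReal} ⊆
        {y | normSqOf (combMat cp A) y ≤ (zMax A v cp).toReal} :=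
      Set.ofPred_subset_ofPred.2 fun _ => le_of_lt
    have hdense := setOf_le_subset_closure_setOf_lt (normSqOf_smul (combMat cp A)) hz
    have hclosure := (Set.image_mono hdense).trans (image_closure_subset_closure_image hcont)
    rwa [(closure_minimal (Set.image_mono hmono) hclosed).antisymm hclosure] at hconv

theorem convex_cutImage (hA : ∀ i, (A i).IsHermitian) (v : Fin m → Fin n → 𝕜)
    (f0 : Fin m → ℝ) (hcp : cp ≠ 0) (hpos : (combMat cp A).PosDef)
    (hdim : Module.finrank ℝ (Fin n → 𝕜) + 1 ≠ m) : Convex ℝ (cutImage A v f0 cp) := by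
  by_cases htop : zMax A v cp = ⊤
  · rw [cutImage_eq_range htop]
    exact convex_range_of_zMax_eq_top hA v f0 hcp hpos hdim htop
  · rw [cutImage_eq_image htop]
    exact (convex_image_centeredMap_le hA v f0 hcp hpos hdim htop).linear_image
      (WithLp.linearEquiv 2 ℝ (Fin m → ℝ)).toLinearMap

end Convexity

end QuadMap

theorem proposition2 {𝕜 : Type*} [RCLike 𝕜] {m n : ℕ}
    (A : Fin m → Matrix (Fin n) (Fin n) 𝕜) (hA : ∀ i, (A i).IsHermitian)
    (v : Fin m → Fin n → 𝕜) (f0 : Fin m → ℝ)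
    (cp : Fin m → ℝ) (hcp : cp ≠ 0) (hpos : (QuadMap.combMat cp A).PosDef)
    (hdim : Module.finrank ℝ (Fin n → 𝕜) + 1 ≠ m) :
    Convex ℝ (QuadMap.cutImage A v f0 cp) ∧
    (QuadMap.zMax A v cp ≠ ⊤ →
      IsCompact (QuadMap.cutImage A v f0 cp) ∧
      QuadMap.cutImage A v f0 cp =
        Set.range (QuadMap.quadMap A v f0) ∩
          {y | cp ⬝ᵥ y ≤ cp ⬝ᵥ QuadMap.quadMap A v f0 (QuadMap.basePoint A v cp)
            + (QuadMap.zMax A v cp).toReal}) ∧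
    (QuadMap.zMax A v cp = ⊤ → Convex ℝ (Set.range (QuadMap.quadMap A v f0))) := by
  refine ⟨QuadMap.convex_cutImage hA v f0 hcp hpos hdim, fun htop => ⟨?_, ?_⟩, fun htop => ?_⟩
  · exact QuadMap.isCompact_cutImage hpos htop
  · exact QuadMap.cutImage_eq_inter hA v f0 hpos htop
  · exact QuadMap.convex_range_of_zMax_eq_top hA v f0 hcp hpos hdim htop
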